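/- All rings are commutative with unity. A monomial preorder on $n$ variables is a strict weak order $<$ on the monomials in $X_1,\dots,X_n$ (distinct monomials may be tied) such that $s<t \iff su<tu$ for all monomials $s,t,u$, and $1<X_i$ for all $i$. A matrix $M\in\mathbb{R}^{m\times n}$ ($m\ge 1$) defines $<$ if, for all $e,f\in\mathbb{N}^n$, $X^e<X^f$ holds if and only if $Me$ is smaller than $Mf$ in the lexicographic order of $\mathbb{R}^m$ (the first differing coordinate decides). Call $<$ rational if it can be defined by a matrix with rational entries, graded if it can be defined by a matrix whose first row has only positive entries, and a monomial order if there are no ties between distinct monomials. Let $A$ be a ring. A sequence $a_1,\dots,a_n\in A$ is $<$-dependent if there is $P\in A[X_1,\dots,X_n]$ with $P(a_1,\dots,a_n)=0$ such that at least one of the minimal monomials of $P$ with respect to $<$ has coefficient $1$ (over the zero ring every sequence counts as dependent). The valuative dimension $\dim_{\mathrm v}(D)$ of an integral domain $D$ is the supremum of the Krull dimensions of all subrings of $\operatorname{Quot}(D)$ containing $D$; for an arbitrary ring $A$, $\dim_{\mathrm v}(A)$ is the supremum of $\dim_{\mathrm v}(A/\mathfrak p)$ over all prime ideals $\mathfrak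 p$ of $A$ ($-\infty$ for the zero ring). **Theorem.** Let $A$ be a ring, $n$ a positive integer, and $<$ a rational monomial preorder on $n$ variables. (a) If $\dim_{\mathrm v}(A)<n$, then every sequence of $n$ elements of $A$ is $<$-dependent. (b) If $<$ is moreover a graded monomial order, then the converse of (a) holds: if every sequence of $n$ elements of $A$ is $<$-dependent, then $\dim_{\mathrm v}(A)<n$. -/

import Mathlib

/-- A monomial preorder on `n` variables: a strict weak order on the monomials
`X₁^{e₁} ⋯ Xₙ^{eₙ}`, written through their exponent vectors, which is compatible with
multiplication and cancellation of monomials and for which `1 < Xᵢ` for all `i`.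
Distinct monomials may be tied, i.e. incomparable. -/
structure MonomialPreorder (n : ℕ) where
  /-- the strict relation `X^e < X^f` -/
  lt : (Fin n →₀ ℕ) → (Fin n →₀ ℕ) → Prop
  irrefl : ∀ e, ¬ lt e e
  trans : ∀ e f g, lt e f → lt f g → lt e g
  tie_trans : ∀ e f g, (¬ lt e f ∧ ¬ lt f e) → (¬ lt f g ∧ ¬ lt g f) → (¬ lt e g ∧ ¬ lt g e)
  add_lt_add_iff : ∀ e f g, lt (e + g) (f + g) ↔ lt e f
  zero_lt_single : ∀ i, lt 0 (Finsupp.single i 1)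

namespace MonomialPreorder

variable {n : ℕ}

/-- The preorder is given by the real matrix `M`: `X^e < X^f` iff `M e` is smaller than `M f` in
the lexicographic order, where the first coordinate in which the vectors differ decides. -/
def IsGivenBy (r : MonomialPreorder n) {m : ℕ} (M : Matrix (Fin m) (Fin n) ℝ) : Prop :=
  ∀ e f : Fin n →₀ ℕ,
    r.lt e f ↔ toLex (M.mulVec fun i => (e i : ℝ)) < toLex (M.mulVec fun i => (f i : ℝ))

/-- Rational: given by some matrix (with at least one row) with rational entries. -/
def IsRational (r : MonomialPreorder n) : Prop :=
  ∃ (m : ℕ) (M : Matrix (Fin (m + 1)) (Fin n) ℚ), r.IsGivenBy (M.map fun q => (q : ℝ))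

/-- Graded: given by some matrix whose first row has only positive entries. -/
def IsGraded (r : MonomialPreorder n) : Prop :=
  ∃ (m : ℕ) (M : Matrix (Fin (m + 1)) (Fin n) ℝ), r.IsGivenBy M ∧ ∀ i, 0 < M 0 i

/-- A monomial order is a monomial preorder without ties between distinct monomials. -/
def IsOrder (r : MonomialPreorder n) : Prop :=
  ∀ e f : Fin n →₀ ℕ, e ≠ f → r.lt e f ∨ r.lt f e

/-- The sequence `a₁, …, aₙ` is dependent with respect to the preorder: some polynomial `P`
vanishing at it has a minimal monomial whose coefficient is `1`. If `1 ≠ 0` in `A`, then `X^e`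
below is automatically a monomial of `P`; over the zero ring every sequence is dependent. -/
def Dependent (r : MonomialPreorder n) {A : Type*} [CommRing A] (a : Fin n → A) : Prop :=
  ∃ P : MvPolynomial (Fin n) A, MvPolynomial.eval a P = 0 ∧
    ∃ e : Fin n →₀ ℕ, P.coeff e = 1 ∧ ∀ f ∈ P.support, ¬ r.lt f e

end MonomialPreorder

/-- The valuative dimension of a domain: the supremum of the Krull dimensions of its overrings,
i.e. of the rings between the domain and its field of fractions. -/
noncomputable def domainValuativeDim (D : Type*) [CommRing D] [IsDomain D] : WithBot ℕ∞ :=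
  ⨆ B : Subalgebra D (FractionRing D), ringKrullDim B

/-- The valuative dimension of a commutative ring: the supremum of the valuative dimensions of its
quotients by prime ideals (`⊥`, i.e. `-∞`, for the zero ring). -/
noncomputable def valuativeDim (A : Type*) [CommRing A] : WithBot ℕ∞ :=
  ⨆ p : PrimeSpectrum A, domainValuativeDim (A ⧸ p.asIdeal)

/-! Both directions compare the given preorder with the lexicographic order on `N e`, for a square
integer matrix `N` in which every row is the leading row of some integer vector
(`IsRational.exists_lexWeight`). This order refines the preorder, so strict dependence for it
implies dependence; for a monomial order the two notions agree.

(a) Suppose `a` is strictly independent. The values at `a` of polynomials with lowest coefficient 1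
form a multiplicative set avoiding 0, so `a` stays independent modulo some prime, and the ring may
be taken to be a domain. In its fraction field the ratios `Q(a) / a ^ g`, with all monomials of `Q`
above `g`, generate a proper ideal, hence consist of nonunits of some valuation overring `V`.
Laurent monomials in `a` whose weights lead in rows 1, ..., n then have infinitely separated sizes
in `V`, which forces `n` steps in a chain of primes (`ValuationRing.natCast_le_ringKrullDim`).

(b) Conversely, elements `x_j` separating the primes of a chain of length `n` in an overring satisfy
no relation whose lexicographically smallest monomial has coefficient 1
(`Ideal.sum_mul_prod_pow_ne_zero_of_chain`). Put `a_i = ∏ x_j ^ N j i`: the exponent `e` in `a`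
becomes `N e` in `x`, so `a` is independent. Gradedness makes the first row of `N` positive;
multiplying `x_0` by a high power of a common denominator therefore brings all `a_i` into the base
domain. -/

namespace MvPolynomial

/-! ### Strict dependence and reduction to domains -/

variable {σ Γ : Type*} [AddCommGroup Γ] [LinearOrder Γ]

/-- `X ^ e` has coefficient `1` in `P`, and every other monomial of `P` has larger `φ`-value. -/
def IsLowestMonic {A : Type*} [CommRing A] (φ : (σ →₀ ℕ) →+ Γ) (P : MvPolynomial σ A)
    (e : σ →₀ ℕ) : Prop :=
  P.coeff e = 1 ∧ ∀ f ∈ P.support, f ≠ e → φ e < φ f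

/-- The family `a` is a zero of a polynomial whose lowest monomial with respect to `φ` is unique
and has coefficient `1`. -/
def StrictlyDependent {A : Type*} [CommRing A] (φ : (σ →₀ ℕ) →+ Γ) (a : σ → A) : Prop :=
  ∃ (P : MvPolynomial σ A) (e : σ →₀ ℕ), P.IsLowestMonic φ e ∧ eval a P = 0

variable {A : Type*} [CommRing A] (φ : (σ →₀ ℕ) →+ Γ)

theorem IsLowestMonic.le {φ : (σ →₀ ℕ) →+ Γ} {P : MvPolynomial σ A} {e f : σ →₀ ℕ}
    (h : P.IsLowestMonic φ e) (hf : f ∈ P.support) : φ e ≤ φ f := by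
  by_cases hfe : f = e
  · rw [hfe]
  · exact (h.2 f hf hfe).le

/-- The two lowest monomials are the only pair whose product has the minimal weight, so nothing can
cancel it. -/
theorem IsLowestMonic.mul [IsOrderedAddMonoid Γ] {φ : (σ →₀ ℕ) →+ Γ} {P Q : MvPolynomial σ A} {d e : σ →₀ ℕ}
    (hP : P.IsLowestMonic φ d) (hQ : Q.IsLowestMonic φ e) : (P * Q).IsLowestMonic φ (d + e) := by
  classical
  have key : ∀ f ∈ P.support, ∀ g ∈ Q.support, (f, g) ≠ (d, e) → φ (d + e) < φ (f + g) := by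
    intro f hf g hg hne
    rw [map_add, map_add]
    by_cases hfd : f = d
    · have hge : g ≠ e := fun h => hne (by rw [hfd, h])
      exact add_lt_add_of_le_of_lt (hP.le hf) (hQ.2 g hg hge)
    · exact add_lt_add_of_lt_of_le (hP.2 f hf hfd) (hQ.le hg)
  refine ⟨?_, ?_⟩
  · rw [coeff_mul, Finset.sum_eq_single (d, e)]
    · rw [hP.1, hQ.1, one_mul]
    · rintro ⟨f, g⟩ hfg hne
      by_contra h
      have hf : f ∈ P.support := mem_support_iff.2 (left_ne_zero_of_mul h)
      have hg : g ∈ Q.support := mem_support_iff.2 (right_ne_zero_of_mul h)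
      have := key f hf g hg hne
      rw [Finset.HasAntidiagonal.mem_antidiagonal.1 hfg] at this
      exact this.false
    · intro h
      rw [Finset.HasAntidiagonal.mem_antidiagonal] at h
      exact absurd (Eq.refl (d + e)) h
  · intro h hh hne
    obtain ⟨f, hf, g, hg, rfl⟩ := Finset.mem_add.1 (support_mul P Q hh)
    refine key f hf g hg fun h => hne ?_
    rw [(Prod.mk.inj h).1, (Prod.mk.inj h).2]

/-- The values at `a` of the polynomials whose lowest monomial has coefficient `1`. -/
def lowestMonicValues [IsOrderedAddMonoid Γ] (a : σ → A) : Submonoid A where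
  carrier := {x | ∃ (P : MvPolynomial σ A) (e : σ →₀ ℕ), P.IsLowestMonic φ e ∧ eval a P = x}
  one_mem' := by
    classical
    refine ⟨1, 0, ⟨by simp, fun f hf hne => absurd ?_ hne⟩, by simp⟩
    by_contra h
    exact mem_support_iff.1 hf (by rw [coeff_one, if_neg (Ne.symm h)])
  mul_mem' := by
    rintro _ _ ⟨P, d, hP, rfl⟩ ⟨Q, e, hQ, rfl⟩
    exact ⟨P * Q, d + e, hP.mul hQ, map_mul _ _ _⟩

/-- A polynomial over a quotient lifts with the same support and a prescribed coefficient `1`. -/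
theorem exists_lift_coeff_eq_one (I : Ideal A) (P : MvPolynomial σ (A ⧸ I)) (e : σ →₀ ℕ)
    (he : P.coeff e = 1) : ∃ Q : MvPolynomial σ A, map (Ideal.Quotient.mk I) Q = P ∧
      Q.coeff e = 1 ∧ ∀ f ∈ Q.support, f ≠ e → f ∈ P.support := by
  classical
  choose s hs using Ideal.Quotient.mk_surjective (I := I)
  let Q : MvPolynomial σ A := monomial e 1 + ∑ f ∈ P.support.erase e, monomial f (s (P.coeff f))
  have hQ : ∀ f, Q.coeff f =
      if e = f then 1 else if f ∈ P.support then s (P.coeff f) else 0 := by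
    intro f
    simp only [Q, coeff_add, coeff_sum, coeff_monomial, Finset.sum_ite_eq', Finset.mem_erase]
    by_cases h : e = f
    · simp [h]
    · simp [h, Ne.symm h]
  refine ⟨Q, ?_, by simp [hQ], ?_⟩
  · ext f
    rw [coeff_map, hQ]
    by_cases h : e = f
    · rw [if_pos h, ← h, he, map_one]
    · rw [if_neg h]
      split_ifs with hf
      · exact hs _
      · rw [map_zero, notMem_support_iff.1 hf]
  · intro f hf hne
    by_contra h
    refine mem_support_iff.1 hf ?_
    rw [hQ, if_neg (Ne.symm hne), if_neg h]

/-- Strict independence survives modulo a suitable prime ideal. -/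
theorem exists_prime_not_strictlyDependent [IsOrderedAddMonoid Γ]
    {a : σ → A} (ha : ¬ StrictlyDependent φ a) :
    ∃ p : PrimeSpectrum A,
      ¬ StrictlyDependent φ (fun i => Ideal.Quotient.mk p.asIdeal (a i)) := by
  have hdisj : Disjoint ((⊥ : Ideal A) : Set A) (lowestMonicValues φ a) := by
    rw [Set.disjoint_left]
    rintro x hx ⟨P, e, hP, hPx⟩
    exact ha ⟨P, e, hP, by rw [hPx]; exact hx⟩
  obtain ⟨p, hp, -, hpS⟩ := Ideal.exists_le_prime_disjoint _ _ hdisj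
  refine ⟨⟨p, hp⟩, ?_⟩
  rintro ⟨P, e, hP, hPa⟩
  obtain ⟨Q, rfl, hQe, hQs⟩ := exists_lift_coeff_eq_one p P e hP.1
  refine Set.disjoint_left.1 hpS (?_ : eval a Q ∈ p)
    ⟨Q, e, ⟨hQe, fun f hf hne => hP.2 f (hQs f hf hne) hne⟩, rfl⟩
  rw [eval_map, ← Function.comp_def, ← eval₂_comp] at hPa
  exact Ideal.Quotient.eq_zero_iff_mem.1 hPa

/-- Dependence of lifts gives dependence modulo an ideal. -/
theorem StrictlyDependent.quotient {φ : (σ →₀ ℕ) →+ Γ} {a : σ → A} (I : Ideal A)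
    (ha : StrictlyDependent φ a) :
    StrictlyDependent φ (fun i => Ideal.Quotient.mk I (a i)) := by
  obtain ⟨P, e, hP, hPa⟩ := ha
  refine ⟨map (Ideal.Quotient.mk I) P, e, ⟨by rw [coeff_map, hP.1, map_one], ?_⟩, ?_⟩
  · intro f hf hne
    exact hP.2 f (support_map_subset _ _ hf) hne
  · rw [eval_map, ← Function.comp_def, ← eval₂_comp, hPa, map_zero]

/-! ### Valuation overrings from independent families -/

section Valuation

variable {K : Type*} [Field K] [Algebra A K]

/-- The ratio `x` is `Q(a) / a ^ g` with all monomials of `Q` above `g`. -/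
def IsPositiveRatio (a : σ → A) (x : K) : Prop :=
  ∃ (g : σ →₀ ℕ) (Q : MvPolynomial σ A), (∀ f ∈ Q.support, φ g < φ f) ∧
    x * algebraMap A K (eval a (monomial g 1)) = algebraMap A K (eval a Q)

variable {φ} {a : σ → A}

theorem IsPositiveRatio.smul {x : K} (hx : IsPositiveRatio φ a x) (c : A) :
    IsPositiveRatio φ a (algebraMap A K c * x) := by
  obtain ⟨g, Q, hQ, h⟩ := hx
  refine ⟨g, C c * Q, fun f hf => hQ f ?_, ?_⟩
  · rw [mem_support_iff, coeff_C_mul] at hf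
    exact mem_support_iff.2 (right_ne_zero_of_mul hf)
  · rw [mul_assoc, h, map_mul, map_mul, eval_C]

theorem lt_of_mem_support_monomial_mul [IsOrderedAddMonoid Γ] {Q : MvPolynomial σ A} {g d : σ →₀ ℕ}
    (hQ : ∀ f ∈ Q.support, φ g < φ f) :
    ∀ f ∈ (monomial d 1 * Q).support, φ (d + g) < φ f := by
  classical
  intro f hf
  obtain ⟨u, hu, v, hv, rfl⟩ := Finset.mem_add.1 (support_mul _ _ hf)
  have : u = d := by simpa using support_monomial_subset hu
  rw [this, map_add, map_add]
  exact add_lt_add_right (hQ v hv) _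

theorem IsPositiveRatio.add [IsOrderedAddMonoid Γ] {x y : K}
    (hx : IsPositiveRatio φ a x) (hy : IsPositiveRatio φ a y) :
    IsPositiveRatio φ a (x + y) := by
  classical
  obtain ⟨g, Q, hQ, h⟩ := hx
  obtain ⟨g', Q', hQ', h'⟩ := hy
  refine ⟨g' + g, monomial g' 1 * Q + monomial g 1 * Q', fun f hf => ?_, ?_⟩
  · rcases Finset.mem_union.1 (support_add hf) with hf | hf
    · exact lt_of_mem_support_monomial_mul hQ f hf
    · rw [add_comm g' g]
      exact lt_of_mem_support_monomial_mul hQ' f hf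
  · have hmon : (monomial (g' + g) 1 : MvPolynomial σ A) = monomial g' 1 * monomial g 1 := by
      rw [monomial_mul, one_mul]
    simp only [hmon, map_mul, map_add, ← h, ← h']
    ring

theorem IsPositiveRatio.mul [IsOrderedAddMonoid Γ] {x y : K}
    (hx : IsPositiveRatio φ a x) (hy : IsPositiveRatio φ a y) :
    IsPositiveRatio φ a (x * y) := by
  classical
  obtain ⟨g, Q, hQ, h⟩ := hx
  obtain ⟨g', Q', hQ', h'⟩ := hy
  refine ⟨g + g', Q * Q', fun f hf => ?_, ?_⟩
  · obtain ⟨u, hu, v, hv, rfl⟩ := Finset.mem_add.1 (support_mul _ _ hf)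
    rw [map_add, map_add]
    exact add_lt_add (hQ u hu) (hQ' v hv)
  · have hmon : (monomial (g + g') 1 : MvPolynomial σ A) = monomial g 1 * monomial g' 1 := by
      rw [monomial_mul, one_mul]
    simp only [hmon, map_mul, ← h, ← h']
    ring

theorem isPositiveRatio_zero : IsPositiveRatio φ a (0 : K) :=
  ⟨0, 0, by simp, by simp⟩

/-- From `a ^ g = Q(a)` one reads off the relation `X ^ g - Q`, whose lowest monomial is `X ^ g`. -/
theorem not_isPositiveRatio_one [FaithfulSMul A K] (ha : ¬ StrictlyDependent φ a) :
    ¬ IsPositiveRatio φ a (1 : K) := by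
  classical
  rintro ⟨g, Q, hQ, h⟩
  rw [one_mul] at h
  have h := FaithfulSMul.algebraMap_injective A K h
  have hg : Q.coeff g = 0 := by
    by_contra hne
    exact (hQ g (mem_support_iff.2 hne)).false
  refine ha ⟨monomial g 1 - Q, g, ⟨by rw [coeff_sub, coeff_monomial, if_pos rfl, hg, sub_zero],
    fun f hf hne => hQ f ?_⟩, by rw [map_sub, h, sub_self]⟩
  rw [mem_support_iff, coeff_sub, coeff_monomial, if_neg hne.symm, zero_sub] at hf
  exact mem_support_iff.2 (neg_ne_zero.1 hf)

variable (φ a K) in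
/-- The subring generated by `A` and the positive ratios. -/
def positiveRatioSubring [IsOrderedAddMonoid Γ] : Subring K where
  carrier := {x | ∃ c : A, IsPositiveRatio φ a (x - algebraMap A K c)}
  zero_mem' := ⟨0, by simpa using isPositiveRatio_zero⟩
  one_mem' := ⟨1, by simpa using isPositiveRatio_zero⟩
  add_mem' := by
    rintro x y ⟨c, hc⟩ ⟨d, hd⟩
    refine ⟨c + d, ?_⟩
    convert hc.add hd using 1
    rw [map_add]; ring
  neg_mem' := by
    rintro x ⟨c, hc⟩
    refine ⟨-c, ?_⟩
    convert hc.smul (-1) using 1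
    rw [map_neg, map_neg, map_one]; ring
  mul_mem' := by
    rintro x y ⟨c, hc⟩ ⟨d, hd⟩
    refine ⟨c * d, ?_⟩
    -- `xy - cd = (x - c)(y - d) + d(x - c) + c(y - d)`.
    convert ((hc.mul hd).add (hc.smul d)).add (hd.smul c) using 1
    rw [map_mul]; ring

variable (φ a K) in
/-- The positive ratios form an ideal. -/
def positiveRatioIdeal [IsOrderedAddMonoid Γ] : Ideal (positiveRatioSubring φ K a) where
  carrier := {x | IsPositiveRatio φ a (x : K)}
  zero_mem' := isPositiveRatio_zero
  add_mem' := fun hx hy => IsPositiveRatio.add hx hy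
  smul_mem' := by
    rintro ⟨x, c, hc⟩ ⟨y, -⟩ (hy : IsPositiveRatio φ a y)
    change IsPositiveRatio φ a (x * y)
    convert (hc.mul hy).add (hy.smul c) using 1
    ring

/-- A strictly independent family of a domain admits a valuation overring in which each Laurent
monomial of positive `φ`-value lies in the maximal ideal. -/
theorem exists_valuationSubring_of_not_strictlyDependent [IsOrderedAddMonoid Γ] [FaithfulSMul A K]
    (ha : ¬ StrictlyDependent φ a) :
    ∃ V : ValuationSubring K, (∀ c : A, algebraMap A K c ∈ V) ∧
      ∀ x : K, IsPositiveRatio φ a x → x ∈ V.nonunits := by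
  have hI : positiveRatioIdeal φ K a ≠ ⊤ := fun h =>
    not_isPositiveRatio_one (K := K) ha ((Ideal.eq_top_iff_one _).1 h)
  obtain ⟨V, hV, hVI⟩ := Ideal.image_subset_nonunits_valuationSubring _ hI
  refine ⟨V, fun c => hV (show _ ∈ positiveRatioSubring φ K a from ⟨c, ?_⟩), fun x hx => ?_⟩
  · rw [sub_self]
    exact isPositiveRatio_zero
  · exact hVI ⟨⟨x, 0, by rwa [map_zero, sub_zero]⟩, hx, rfl⟩

end Valuation

end MvPolynomial

/-! ### Chains of primes in valuation rings -/

/-- In a valuation ring, elements of pairwise incomparable orders of magnitude bound the Krull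
dimension from below. -/
theorem ValuationRing.natCast_le_ringKrullDim {R : Type*} [CommRing R] [IsDomain R]
    [ValuationRing R] {n : ℕ} (b : Fin n → R) (hb : ∀ i, b i ≠ 0) (hbu : ∀ i, ¬ IsUnit (b i))
    (hlt : ∀ i j, i < j → ∀ k : ℕ, ∃ m, ¬ IsUnit m ∧ b i = b j ^ k * m) :
    (n : WithBot ℕ∞) ≤ ringKrullDim R := by
  have hprime : ∀ i, (Ideal.span {b i}).radical.IsPrime := by
    intro i
    refine ⟨fun h => hbu i ?_, fun {x y} hxy => ?_⟩
    · rw [Ideal.radical_eq_top, Ideal.span_singleton_eq_top] at h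
      exact h
    -- If `x ∣ y`, then `y ^ 2` is a multiple of `x * y`; as divisibility is total, the radical is
    -- prime.
    · have aux : ∀ {x y : R}, x * y ∈ (Ideal.span {b i}).radical → x ∣ y →
          y ∈ (Ideal.span {b i}).radical := by
        rintro x _ hxy ⟨c, rfl⟩
        refine Ideal.mem_radical_of_pow_mem (m := 2) ?_
        rw [show (x * c) ^ 2 = c * (x * (x * c)) by ring]
        exact Ideal.mul_mem_left _ _ hxy
      rcases ValuationRing.dvd_total x y with h | h
      · exact Or.inr (aux hxy h)
      · exact Or.inl (aux (mul_comm x y ▸ hxy) h)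
  let P : Fin n → PrimeSpectrum R := fun i => ⟨_, hprime i⟩
  have hmem : ∀ i, b i ∈ (P i).asIdeal := fun i =>
    Ideal.le_radical (Ideal.mem_span_singleton_self _)
  have hmono : StrictMono P := by
    intro i j hij
    rw [← PrimeSpectrum.asIdeal_lt_asIdeal]
    refine SetLike.lt_iff_le_and_exists.2 ⟨?_, b j, hmem j, ?_⟩
    · refine Ideal.radical_mono ?_
      rw [Ideal.span_singleton_le_span_singleton]
      obtain ⟨m, -, hm⟩ := hlt i j hij 1
      exact ⟨m, by rw [hm, pow_one]⟩
    -- If `b i` divided `b j ^ k`, cancelling `b j ^ k` would make the nonunit `m` invertible.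
    · rintro ⟨k, hk⟩
      obtain ⟨c, hc⟩ := Ideal.mem_span_singleton.1 hk
      obtain ⟨m, hmu, hm⟩ := hlt i j hij k
      have h1 : b j ^ k * (m * c) = b j ^ k * 1 := by rw [← mul_assoc, ← hm, ← hc, mul_one]
      exact hmu (IsUnit.of_mul_eq_one c (mul_left_cancel₀ (pow_ne_zero k (hb j)) h1))
  -- The `n` radicals give only `n - 1` steps; the zero ideal supplies the remaining one.
  let Q : Fin (n + 1) → PrimeSpectrum R := Fin.cons ⊥ P
  have hQ : StrictMono Q := by
    refine Fin.strictMono_iff_lt_succ.2 fun i => ?_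
    cases n with
    | zero => exact i.elim0
    | succ n =>
      refine Fin.cases ?_ (fun j => ?_) i
      · change (⊥ : PrimeSpectrum R) < P 0
        rw [bot_lt_iff_ne_bot]
        intro h
        have := hmem 0
        rw [h] at this
        exact hb 0 this
      · exact hmono (Fin.castSucc_lt_succ (i := j))
  exact Order.le_krullDim_iff.2 ⟨LTSeries.mk n Q hQ, rfl⟩

/-! ### Lexicographic weights and the lower bound on the valuative dimension -/

namespace MvPolynomial

/-- The `ℤ`-valued lexicographic weight of exponent vectors defined by a matrix. -/
def lexWeight {n : ℕ} (N : Matrix (Fin n) (Fin n) ℤ) : (Fin n →₀ ℕ) →+ Lex (Fin n → ℤ) where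
  toFun e := toLex (N.mulVec fun i => (e i : ℤ))
  map_zero' := by
    simp only [Finsupp.coe_zero, Pi.zero_apply, Nat.cast_zero]
    exact congrArg toLex (Matrix.mulVec_zero N)
  map_add' e f := by
    rw [← toLex_add, ← Matrix.mulVec_add]
    congr 2

theorem lexWeight_lt_iff {n : ℕ} {N : Matrix (Fin n) (Fin n) ℤ} {e f : Fin n →₀ ℕ} :
    lexWeight N e < lexWeight N f ↔
      ∃ i, (∀ j < i, N.mulVec (fun i => (f i : ℤ) - e i) j = 0) ∧
        0 < N.mulVec (fun i => (f i : ℤ) - e i) i := by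
  have h : N.mulVec (fun i => (f i : ℤ) - e i) =
      N.mulVec (fun i => (f i : ℤ)) - N.mulVec (fun i => (e i : ℤ)) := by
    rw [← Matrix.mulVec_sub]
    rfl
  rw [h]
  simp only [Pi.sub_apply, sub_pos, sub_eq_zero]
  constructor
  · rintro ⟨i, h1, h2⟩
    exact ⟨i, fun j hj => (h1 j hj).symm, h2⟩
  · rintro ⟨i, h1, h2⟩
    exact ⟨i, fun j hj => (h1 j hj).symm, h2⟩

theorem StrictlyDependent.of_eq_zero {σ Γ A : Type*} [AddCommGroup Γ] [LinearOrder Γ]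
    [CommRing A] (φ : (σ →₀ ℕ) →+ Γ) {a : σ → A} {i : σ} (hi : a i = 0) :
    StrictlyDependent φ a := by
  classical
  refine ⟨X i, Finsupp.single i 1, ⟨by simp [coeff_X], fun f hf hne => absurd ?_ hne⟩, by rw [eval_X, hi]⟩
  exact Finset.mem_singleton.1 (support_monomial_subset hf)

theorem eval_monomial_ne_zero {σ D : Type*} [CommRing D] [IsDomain D] {a : σ → D}
    (ha : ∀ i, a i ≠ 0) (f : σ →₀ ℕ) : eval a (monomial f 1) ≠ 0 := by
  rw [eval_monomial, one_mul]
  exact Finset.prod_ne_zero_iff.2 fun i _ => pow_ne_zero _ (ha i)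

/-- If a sequence in a domain is strictly independent for a lexicographic weight of full rank,
then the valuative dimension is at least the length of the sequence. -/
theorem natCast_le_domainValuativeDim {D : Type*} [CommRing D] [IsDomain D] {n : ℕ}
    {N : Matrix (Fin n) (Fin n) ℤ}
    (hN : ∀ i, ∃ y : Fin n → ℤ, (∀ j < i, N.mulVec y j = 0) ∧ 0 < N.mulVec y i)
    {a : Fin n → D} (ha : ¬ StrictlyDependent (lexWeight N) a) :
    (n : WithBot ℕ∞) ≤ domainValuativeDim D := by
  obtain ⟨V, hDV, hV⟩ :=
    exists_valuationSubring_of_not_strictlyDependent (K := FractionRing D) ha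
  have ha0 : ∀ i, a i ≠ 0 := fun i hi => ha (StrictlyDependent.of_eq_zero _ hi)
  choose y hy0 hy using hN
  let mon : (Fin n →₀ ℕ) → FractionRing D :=
    fun f => algebraMap D (FractionRing D) (eval a (monomial f 1))
  have mon_ne : ∀ f, mon f ≠ 0 := fun f => by
    rw [Ne, FaithfulSMul.algebraMap_eq_zero_iff]
    exact eval_monomial_ne_zero ha0 f
  have mon_add : ∀ f g, mon (f + g) = mon f * mon g := fun f g => by
    simp only [mon, ← map_mul, monomial_mul, one_mul]
  have mon_nsmul : ∀ (k : ℕ) f, mon (k • f) = mon f ^ k := fun k f => by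
    simp only [mon, ← map_pow, monomial_pow, one_pow]
  have mon_div : ∀ f g, lexWeight N g < lexWeight N f → mon f / mon g ∈ V.nonunits := by
    intro f g hfg
    refine hV _ ⟨g, monomial f 1, fun u hu => ?_, div_mul_cancel₀ _ (mon_ne g)⟩
    rwa [Finset.mem_singleton.1 (support_monomial_subset hu)]
  -- Positive and negative parts of `y i`: the Laurent monomial `a ^ y i` is `mon (pos i) / mon (neg
  -- i)`.
  let pos : Fin n → (Fin n →₀ ℕ) := fun i => Finsupp.equivFunOnFinite.symm fun j => (y i j).toNat
  let neg : Fin n → (Fin n →₀ ℕ) :=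
    fun i => Finsupp.equivFunOnFinite.symm fun j => (-(y i j)).toNat
  have hpn : ∀ i j, ((pos i j : ℕ) : ℤ) - (neg i j : ℕ) = y i j := fun i j =>
    Int.toNat_sub_toNat_neg (y i j)
  have h1 : ∀ i, lexWeight N (neg i) < lexWeight N (pos i) := fun i => by
    rw [lexWeight_lt_iff]
    simp only [hpn]
    exact ⟨i, hy0 i, hy i⟩
  -- Since `N (y j)` vanishes in row `i` and above, subtracting any multiple of `y j` from `y i`
  -- leaves the leading entry unchanged.
  have h2 : ∀ i j, i < j → ∀ k : ℕ,
      lexWeight N (neg i + k • pos j) < lexWeight N (pos i + k • neg j) := by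
    intro i j hij k
    rw [lexWeight_lt_iff]
    have : (fun l => (((pos i + k • neg j) l : ℕ) : ℤ) - ((neg i + k • pos j) l : ℕ)) =
        y i - (k : ℤ) • y j := by
      ext l
      simp only [Finsupp.add_apply, Finsupp.smul_apply, smul_eq_mul, Nat.cast_add, Nat.cast_mul,
        Pi.sub_apply, Pi.smul_apply, ← hpn]
      ring
    rw [this, Matrix.mulVec_sub, Matrix.mulVec_smul]
    simp only [Pi.sub_apply, Pi.smul_apply, smul_eq_mul]
    refine ⟨i, fun l hl => ?_, ?_⟩
    · rw [hy0 i l hl, hy0 j l (hl.trans hij), mul_zero, sub_zero]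
    · rw [hy0 j i hij, mul_zero, sub_zero]
      exact hy i
  have hnon : ∀ x : FractionRing D, x ∈ V.nonunits → ∃ m : V, ¬ IsUnit m ∧ (m : FractionRing D) = x :=
    fun x hx => by
      obtain ⟨h, h'⟩ := V.mem_nonunits_iff_exists_mem_maximalIdeal.1 hx
      exact ⟨⟨x, h⟩, h', rfl⟩
  choose b hbu hb using fun i => hnon _ (mon_div _ _ (h1 i))
  have hdim : (n : WithBot ℕ∞) ≤ ringKrullDim V := by
    refine ValuationRing.natCast_le_ringKrullDim b (fun i hi => ?_) hbu fun i j hij k => ?_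
    · have := hb i
      rw [hi] at this
      exact div_ne_zero (mon_ne _) (mon_ne _) this.symm
    · obtain ⟨m, hmu, hm⟩ := hnon _ (mon_div _ _ (h2 i j hij k))
      refine ⟨m, hmu, Subtype.ext ?_⟩
      rw [V.coe_mul, V.coe_pow, hb, hb, hm, mon_add, mon_add, mon_nsmul, mon_nsmul, div_pow]
      have := mon_ne (pos i)
      have := mon_ne (pos j)
      have := mon_ne (neg i)
      have := mon_ne (neg j)
      field_simp
  let B : Subalgebra D (FractionRing D) := { V.toSubring with algebraMap_mem' := hDV }
  have hB : ringKrullDim B = ringKrullDim V :=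
    ringKrullDim_eq_of_ringEquiv (RingEquiv.refl V : V ≃+* V)
  exact hdim.trans (hB ▸ le_iSup (fun B : Subalgebra D (FractionRing D) => ringKrullDim B) B)

theorem strictlyDependent_of_valuativeDim_lt {A : Type*} [CommRing A] {n : ℕ}
    {N : Matrix (Fin n) (Fin n) ℤ}
    (hN : ∀ i, ∃ y : Fin n → ℤ, (∀ j < i, N.mulVec y j = 0) ∧ 0 < N.mulVec y i)
    (hA : valuativeDim A < n) (a : Fin n → A) : StrictlyDependent (lexWeight N) a := by
  by_contra ha
  obtain ⟨p, hp⟩ := exists_prime_not_strictlyDependent _ ha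
  exact (natCast_le_domainValuativeDim hN hp).not_gt ((le_iSup
    (fun p : PrimeSpectrum A => domainValuativeDim (A ⧸ p.asIdeal)) p).trans_lt hA)

end MvPolynomial

/-! ### Replacing a rational matrix by a square integer one -/

theorem Rat.exists_natCast_mul_eq_intCast {ι : Type*} [Fintype ι] (v : ι → ℚ) :
    ∃ d : ℕ, 0 < d ∧ ∃ z : ι → ℤ, ∀ i, (d : ℚ) * v i = z i := by
  classical
  refine ⟨∏ i, (v i).den, Finset.prod_pos fun i _ => (v i).den_pos,
    fun i => (∏ j ∈ Finset.univ.erase i, ((v j).den : ℤ)) * (v i).num, fun i => ?_⟩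
  rw [← Finset.prod_erase_mul _ _ (Finset.mem_univ i)]
  push_cast
  rw [mul_assoc, mul_comm ((v i).den : ℚ), Rat.mul_den_eq_num]

namespace Matrix

variable {n : ℕ} {ι : Type*} [Fintype ι] [LinearOrder ι]

/-- The row `k` is the first one in which `M v` does not vanish. -/
def IsLeadingRow (M : Matrix ι (Fin n) ℚ) (v : Fin n → ℚ) (k : ι) : Prop :=
  (∀ j < k, M.mulVec v j = 0) ∧ M.mulVec v k ≠ 0

theorem exists_isLeadingRow {M : Matrix ι (Fin n) ℚ} {v : Fin n → ℚ} (h : M.mulVec v ≠ 0) :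
    ∃ k, M.IsLeadingRow v k := by
  classical
  obtain ⟨k₀, hk₀⟩ := Function.ne_iff.1 h
  have hne : (Finset.univ.filter fun k => M.mulVec v k ≠ 0).Nonempty :=
    ⟨k₀, Finset.mem_filter.2 ⟨Finset.mem_univ _, hk₀⟩⟩
  refine ⟨Finset.min' _ hne, fun j hj => ?_, (Finset.mem_filter.1 (Finset.min'_mem _ hne)).2⟩
  by_contra hj0
  exact hj.not_ge (Finset.min'_le _ j (Finset.mem_filter.2 ⟨Finset.mem_univ _, hj0⟩))

/-- A matrix with trivial kernel has as many leading rows as columns. -/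
theorem card_leadingRows {M : Matrix ι (Fin n) ℚ} (hM : ∀ v, M.mulVec v = 0 → v = 0)
    (L : Finset ι) (hL : ∀ k, k ∈ L ↔ ∃ v, M.IsLeadingRow v k) : L.card = n := by
  classical
  apply le_antisymm
  -- Vectors with distinct leading rows are linearly independent: in a combination, the first one
  -- with nonzero coefficient cannot be cancelled in its leading row.
  · choose w hw using fun l : L => (hL l).1 l.2
    let S : (L → ℚ) →ₗ[ℚ] (Fin n → ℚ) := Fintype.linearCombination ℚ w
    have hS : Function.Injective S := by
      rw [injective_iff_map_eq_zero]
      intro c hc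
      by_contra hne
      obtain ⟨l₀, hl₀⟩ := Function.ne_iff.1 hne
      have hnonempty : (Finset.univ.filter fun l => c l ≠ 0).Nonempty :=
        ⟨l₀, Finset.mem_filter.2 ⟨Finset.mem_univ _, hl₀⟩⟩
      set l := Finset.min' _ hnonempty with hl
      have hcl : c l ≠ 0 := (Finset.mem_filter.1 (Finset.min'_mem _ hnonempty)).2
      have hlt : ∀ k, k < l → c k = 0 := fun k hk => by
        by_contra hk0
        exact hk.not_ge (Finset.min'_le _ k (Finset.mem_filter.2 ⟨Finset.mem_univ _, hk0⟩))
      have h0 : M.mulVec (S c) l = 0 := by rw [hc, mulVec_zero]; rfl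
      have hSc : M.mulVec (S c) l = ∑ k, c k * M.mulVec (w k) l := by
        have : M.mulVec (S c) = ∑ k, c k • M.mulVec (w k) := by
          change M.mulVecLin (S c) = ∑ k, c k • M.mulVecLin (w k)
          rw [Fintype.linearCombination_apply, map_sum]
          simp only [map_smul]
        rw [this, Finset.sum_apply]
        rfl
      rw [hSc, Finset.sum_eq_single l] at h0
      · exact mul_ne_zero hcl (hw l).2 h0
      · intro k _ hkl
        rcases lt_or_gt_of_ne hkl with h | h
        · rw [hlt k h, zero_mul]
        · rw [(hw k).1 l h, mul_zero]
      · exact fun h => absurd (Finset.mem_univ _) h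
    simpa using LinearMap.finrank_le_finrank_of_injective hS
  -- Restricting to the leading rows keeps the kernel trivial, because a nonzero vector is detected
  -- by its own leading row.
  · let T : (Fin n → ℚ) →ₗ[ℚ] (L → ℚ) := (LinearMap.funLeft ℚ ℚ (Subtype.val : L → ι)) ∘ₗ M.mulVecLin
    have hT : Function.Injective T := by
      rw [injective_iff_map_eq_zero]
      intro v hv
      by_contra hne
      obtain ⟨k, hk⟩ := exists_isLeadingRow (mt (hM v) hne)
      exact hk.2 (congrFun hv ⟨k, (hL k).2 ⟨v, hk⟩⟩)
    simpa using LinearMap.finrank_le_finrank_of_injective hT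

theorem mulVec_intCast {m : Type*} (N : Matrix m (Fin n) ℤ) (v : Fin n → ℤ) (i : m) :
    ((N.mulVec v i : ℤ) : ℚ) = (N.map fun z => (z : ℚ)).mulVec (fun j => (v j : ℚ)) i := by
  simp [mulVec, dotProduct]

/-- The lexicographic order defined by a rational matrix with trivial kernel can be defined by a
square integer matrix for which all rows are leading. -/
theorem exists_square_lexPos (M : Matrix ι (Fin n) ℚ) (hM : ∀ v, M.mulVec v = 0 → v = 0) :
    ∃ N : Matrix (Fin n) (Fin n) ℤ,
      (∀ i, ∃ y : Fin n → ℤ, (∀ j < i, N.mulVec y j = 0) ∧ 0 < N.mulVec y i) ∧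
      ∀ v : Fin n → ℤ,
        (∃ i, (∀ j < i, M.mulVec (fun l => (v l : ℚ)) j = 0) ∧
          0 < M.mulVec (fun l => (v l : ℚ)) i) →
        ∃ i, (∀ j < i, N.mulVec v j = 0) ∧ 0 < N.mulVec v i := by
  classical
  let L : Finset ι := Finset.univ.filter fun k => ∃ v, M.IsLeadingRow v k
  have hL : ∀ k, k ∈ L ↔ ∃ v, M.IsLeadingRow v k := fun k => by simp [L]
  let emb : Fin n ↪o ι := L.orderEmbOfFin (card_leadingRows hM L hL)
  have hmem : ∀ i, emb i ∈ L := fun i => Finset.orderEmbOfFin_mem _ _ i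
  have hsurj : ∀ k ∈ L, ∃ i, emb i = k := fun k hk => by
    have : k ∈ Set.range emb := by
      rw [Finset.range_orderEmbOfFin]
      exact hk
    exact this
  -- Each row is scaled by its own positive denominator, which preserves zeros and signs of its
  -- values.
  choose d hd N hN using fun i => Rat.exists_natCast_mul_eq_intCast (M (emb i))
  have hdq : ∀ i, (0 : ℚ) < d i := fun i => Nat.cast_pos.2 (hd i)
  have key : ∀ (v : Fin n → ℤ) i, ((Matrix.mulVec (Matrix.of N) v i : ℤ) : ℚ) =
      d i * M.mulVec (fun l => (v l : ℚ)) (emb i) := by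
    intro v i
    rw [mulVec_intCast]
    simp only [mulVec, dotProduct, map_apply, of_apply, ← hN, Finset.mul_sum, mul_assoc]
  have key0 : ∀ (v : Fin n → ℤ) i, Matrix.mulVec (Matrix.of N) v i = 0 ↔
      M.mulVec (fun l => (v l : ℚ)) (emb i) = 0 := by
    intro v i
    rw [← Int.cast_eq_zero (α := ℚ), key, mul_eq_zero, or_iff_right (hdq i).ne']
  have keypos : ∀ (v : Fin n → ℤ) i, 0 < Matrix.mulVec (Matrix.of N) v i ↔
      0 < M.mulVec (fun l => (v l : ℚ)) (emb i) := by
    intro v i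
    rw [← Int.cast_pos (R := ℚ), key, mul_pos_iff_of_pos_left (hdq i)]
  refine ⟨Matrix.of N, fun i => ?_, ?_⟩
  · obtain ⟨v, hv0, hv⟩ := (hL _).1 (hmem i)
    obtain ⟨w, hw0, hw⟩ : ∃ w, (∀ j < emb i, M.mulVec w j = 0) ∧ 0 < M.mulVec w (emb i) := by
      rcases lt_or_gt_of_ne hv with h | h
      · refine ⟨-v, fun j hj => ?_, ?_⟩
        · rw [mulVec_neg, Pi.neg_apply, hv0 j hj, neg_zero]
        · rw [mulVec_neg, Pi.neg_apply]
          exact neg_pos.2 h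
      · exact ⟨v, hv0, h⟩
    obtain ⟨c, hc, y, hy⟩ := Rat.exists_natCast_mul_eq_intCast w
    have hyw : (fun l => (y l : ℚ)) = (c : ℚ) • w := funext fun l => (hy l).symm
    refine ⟨y, fun j hj => ?_, ?_⟩
    · rw [key0, hyw, mulVec_smul, Pi.smul_apply, hw0 _ (emb.strictMono hj), smul_zero]
    · rw [keypos, hyw, mulVec_smul, Pi.smul_apply]
      exact mul_pos (Nat.cast_pos.2 hc) hw
  · rintro v ⟨k, hk0, hk⟩
    obtain ⟨i, rfl⟩ := hsurj k ((hL k).2 ⟨_, hk0, hk.ne'⟩)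
    exact ⟨i, fun j hj => (key0 v j).2 (hk0 _ (emb.strictMono hj)), (keypos v i).2 hk⟩

end Matrix

namespace MonomialPreorder

open MvPolynomial

/-- A rational monomial preorder is refined by a lexicographic weight of full rank. -/
theorem IsRational.exists_lexWeight {n : ℕ} {r : MonomialPreorder n} (hr : r.IsRational) :
    ∃ N : Matrix (Fin n) (Fin n) ℤ,
      (∀ i, ∃ y : Fin n → ℤ, (∀ j < i, N.mulVec y j = 0) ∧ 0 < N.mulVec y i) ∧
      ∀ e f, r.lt e f → lexWeight N e < lexWeight N f := by
  obtain ⟨m, M, hM⟩ := hr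
  -- Identity rows placed below `M` break all ties, so the kernel becomes trivial, without changing
  -- any comparison decided by `M`.
  let M' : Matrix (Fin (m + 1) ⊕ₗ Fin n) (Fin n) ℚ :=
    fun k => Sum.elim M (1 : Matrix (Fin n) (Fin n) ℚ) (ofLex k)
  have hM'inl : ∀ v i, M'.mulVec v (Sum.inlₗ i) = M.mulVec v i := fun v i => rfl
  have hM'inr : ∀ v i, M'.mulVec v (Sum.inrₗ i) = v i := fun v i =>
    congrFun (Matrix.one_mulVec v) i
  obtain ⟨N, hN, hMN⟩ := Matrix.exists_square_lexPos M' fun v hv => funext fun i =>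
    (hM'inr v i).symm.trans (congrFun hv _)
  refine ⟨N, hN, fun e f hef => lexWeight_lt_iff.2 (hMN (fun i => (f i : ℤ) - e i) ?_)⟩
  obtain ⟨i, hi0, hi⟩ := (hM e f).1 hef
  have hcast : ∀ (g : Fin n →₀ ℕ) (j : Fin (m + 1)),
      (M.map fun q => (q : ℝ)).mulVec (fun i => (g i : ℝ)) j =
        ((M.mulVec (fun i => (g i : ℚ)) j : ℚ) : ℝ) := fun g j => by
    simp [Matrix.mulVec, dotProduct]
  have hsub : ∀ j, M'.mulVec (fun l => (((f l : ℤ) - e l : ℤ) : ℚ)) (Sum.inlₗ j) =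
      M.mulVec (fun i => (f i : ℚ)) j - M.mulVec (fun i => (e i : ℚ)) j := fun j => by
    rw [hM'inl, ← Pi.sub_apply, ← Matrix.mulVec_sub]
    congr 1
    ext l
    simp
  refine ⟨Sum.inlₗ i, fun j hj => ?_, ?_⟩
  · obtain ⟨j | j, rfl⟩ := toLex.surjective j
    · have hji : j < i := Sum.Lex.inl_lt_inl_iff.1 hj
      have h := hi0 j hji
      simp only [Pi.toLex_apply, hcast, Rat.cast_inj] at h
      exact (hsub j).trans (sub_eq_zero.2 h.symm)
    · exact absurd hj Sum.Lex.not_inr_lt_inl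
  · simp only [Pi.toLex_apply, hcast, Rat.cast_lt] at hi
    rw [hsub]
    exact sub_pos.2 hi

end MonomialPreorder

/-! ### Independent sequences from chains of primes -/

/-- Elements separating the members of a chain of primes satisfy no relation whose
lexicographically smallest monomial has coefficient `1`. -/
theorem Ideal.sum_mul_prod_pow_ne_zero_of_chain {B σ : Type*} [CommRing B] {n : ℕ}
    {P : Fin (n + 1) → Ideal B} (hP : ∀ i, (P i).IsPrime) (hmono : Monotone P)
    {x : Fin n → B} (hx : ∀ i, x i ∈ P i.succ) (hx' : ∀ i, x i ∉ P i.castSucc)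
    (s : Finset σ) (c : σ → B) (u : σ → Fin n → ℕ) {e : σ} (he : e ∈ s) (hc : c e = 1)
    (hlex : ∀ f ∈ s, f ≠ e → ∃ i, (∀ j < i, u e j = u f j) ∧ u e i < u f i) :
    ∑ f ∈ s, c f * ∏ j, x j ^ u f j ≠ 0 := by
  classical
  intro hsum
  -- `T k` keeps the terms agreeing with `e` in the variables before `k` and drops the powers of
  -- those variables. Thus `T 0` is the whole sum, assumed zero, and the last `T` is 1; the
  -- contradiction comes from `T k ∈ P k`.
  let T : Fin (n + 1) → B := fun k =>
    ∑ f ∈ s with ∀ j : Fin n, j.castSucc < k → u f j = u e j,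
      c f * ∏ j : Fin n with k ≤ j.castSucc, x j ^ u f j
  have hT : ∀ k, T k ∈ P k := by
    intro k
    induction k using Fin.induction with
    | zero =>
      have : T 0 = 0 := by
        rw [← hsum]
        simp [T]
      rw [this]
      exact zero_mem _
    | succ i ih =>
      have hprod : ∀ f, ∏ j : Fin n with i.castSucc ≤ j.castSucc, x j ^ u f j =
          x i ^ u f i * ∏ j : Fin n with i.succ ≤ j.castSucc, x j ^ u f j := by
        intro f
        rw [← Finset.prod_insert (f := fun j => x j ^ u f j) (a := i)]
        · congr 1
          ext j
          simp only [Finset.mem_filter, Finset.mem_univ, true_and, Finset.mem_insert, Fin.le_def,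
            Fin.ext_iff, Fin.val_castSucc, Fin.val_succ]
          omega
        · simp [Fin.le_def]
      have hle : ∀ f ∈ s, (∀ j : Fin n, j.castSucc < i.castSucc → u f j = u e j) →
          u e i ≤ u f i := by
        intro f hf hfe
        by_cases hne : f = e
        · rw [hne]
        obtain ⟨i₀, h1, h2⟩ := hlex f hf hne
        rcases lt_trichotomy i₀ i with h | h | h
        · exact absurd (hfe i₀ h) h2.ne'
        · exact h ▸ h2.le
        · exact (h1 i h).le
      -- The cofactor of `x i ^ u e i`. It lies in `P i.castSucc` by primality; modulo `P i.succ`,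
      -- terms still divisible by `x i` vanish and `T i.succ` remains.
      let Y : B := ∑ f ∈ s with ∀ j : Fin n, j.castSucc < i.castSucc → u f j = u e j,
        c f * (x i ^ (u f i - u e i) * ∏ j : Fin n with i.succ ≤ j.castSucc, x j ^ u f j)
      have hTY : T i.castSucc = x i ^ u e i * Y := by
        simp only [T, Y, Finset.mul_sum]
        refine Finset.sum_congr rfl fun f hf => ?_
        obtain ⟨hfs, hfe⟩ := Finset.mem_filter.1 hf
        rw [hprod, ← Nat.add_sub_cancel' (hle f hfs hfe), pow_add, Nat.add_sub_cancel_left]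
        ring
      have hY : Y ∈ P i.succ := by
        rw [hTY] at ih
        refine hmono (Fin.castSucc_lt_succ (i := i)).le
          (((hP _).mem_or_mem ih).resolve_left fun h => hx' i ((hP _).mem_of_pow_mem _ h))
      have hsplit : Y = T i.succ +
          ∑ f ∈ (s.filter fun f => ∀ j : Fin n, j.castSucc < i.castSucc → u f j = u e j) with
            ¬ u f i = u e i,
          c f * (x i ^ (u f i - u e i) * ∏ j : Fin n with i.succ ≤ j.castSucc, x j ^ u f j) := by
        simp only [Y]
        rw [← Finset.sum_filter_add_sum_filter_not _ (fun f => u f i = u e i)]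
        congr 1
        refine Finset.sum_congr ?_ fun f hf => ?_
        · ext f
          simp only [Finset.mem_filter, and_assoc]
          refine and_congr_right fun _ => ⟨fun h j hj => ?_, fun h => ⟨fun j hj => ?_, ?_⟩⟩
          · rcases (Fin.castSucc_lt_succ_iff.1 hj).lt_or_eq with h' | h'
            · exact h.1 j h'
            · exact h' ▸ h.2
          · exact h j (hj.trans Fin.castSucc_lt_succ)
          · exact h i Fin.castSucc_lt_succ
        · rw [(Finset.mem_filter.1 hf).2 i Fin.castSucc_lt_succ, Nat.sub_self, pow_zero, one_mul]
      rw [hsplit] at hY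
      refine (Ideal.add_mem_iff_left _ (Ideal.sum_mem _ fun f hf => ?_)).1 hY
      obtain ⟨hf, hne⟩ := Finset.mem_filter.1 hf
      obtain ⟨hfs, hfe⟩ := Finset.mem_filter.1 hf
      refine Ideal.mul_mem_left _ _ (Ideal.mul_mem_right _ _ (Ideal.pow_mem_of_mem _ (hx i) _ ?_))
      exact Nat.sub_pos_of_lt (lt_of_le_of_ne (hle f hfs hfe) (Ne.symm hne))
  refine (hP (Fin.last n)).ne_top ((Ideal.eq_top_iff_one _).2 ?_)
  convert hT (Fin.last n)
  simp only [T]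
  rw [Finset.sum_eq_single e]
  · rw [hc, one_mul, Finset.prod_eq_one]
    intro j hj
    exact absurd (Finset.mem_filter.1 hj).2 (Fin.castSucc_lt_last j).not_ge
  · intro f hf hne
    obtain ⟨hfs, hfe⟩ := Finset.mem_filter.1 hf
    obtain ⟨i, -, h⟩ := hlex f hfs hne
    exact absurd (hfe i (Fin.castSucc_lt_last i)) h.ne'
  · intro h
    exact absurd (Finset.mem_filter.2 ⟨he, fun _ _ => rfl⟩) h

namespace MvPolynomial

/-- Laurent monomials, with exponents the columns of `N`, in elements separating a chain of primes
are strictly independent with respect to the lexicographic weight of `N`. -/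
theorem not_strictlyDependent_of_chain {D K : Type*} [CommRing D] [Nontrivial D] [Field K]
    [Algebra D K] [FaithfulSMul D K] {n : ℕ} (N : Matrix (Fin n) (Fin n) ℤ) (B : Subalgebra D K)
    {P : Fin (n + 1) → Ideal B} (hP : ∀ i, (P i).IsPrime) (hmono : Monotone P)
    {x : Fin n → B} (hx : ∀ i, x i ∈ P i.succ) (hx' : ∀ i, x i ∉ P i.castSucc) {a : Fin n → D}
    (ha : ∀ i, algebraMap D K (a i) = ∏ j, (x j : K) ^ N j i) :
    ¬ StrictlyDependent (lexWeight N) a := by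
  classical
  rintro ⟨Q, e, ⟨he, hQ⟩, hQa⟩
  have hx0 : ∀ j, (x j : K) ≠ 0 := fun j hj =>
    hx' j (by rw [show x j = 0 from Subtype.ext hj]; exact zero_mem _)
  let w : (Fin n →₀ ℕ) → Fin n → ℤ := fun f => N.mulVec fun i => (f i : ℤ)
  have hmon : ∀ f : Fin n →₀ ℕ, ∏ i, (algebraMap D K (a i)) ^ f i = ∏ j, (x j : K) ^ w f j := by
    intro f
    simp only [ha, ← Finset.prod_pow]
    rw [Finset.prod_comm]
    refine Finset.prod_congr rfl fun j _ => ?_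
    simp only [w, Matrix.mulVec, dotProduct, ← zpow_natCast, ← zpow_mul]
    generalize (Finset.univ : Finset (Fin n)) = t
    induction t using Finset.induction_on with
    | empty => simp
    | insert i t hi ih => rw [Finset.prod_insert hi, Finset.sum_insert hi, ih, zpow_add₀ (hx0 j)]
  -- A uniform shift making all occurring Laurent exponents nonnegative without altering their
  -- lexicographic comparison.
  let H : ℕ := ∑ f ∈ Q.support, ∑ j, (w f j).natAbs
  have hH : ∀ f ∈ Q.support, ∀ j, 0 ≤ w f j + H := by
    intro f hf j
    have h1 : (w f j).natAbs ≤ ∑ j, (w f j).natAbs :=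
      Finset.single_le_sum (f := fun j => (w f j).natAbs) (fun _ _ => Nat.zero_le _)
        (Finset.mem_univ j)
    have h2 : ∑ j, (w f j).natAbs ≤ H :=
      Finset.single_le_sum (f := fun f => ∑ j, (w f j).natAbs) (fun _ _ => Nat.zero_le _) hf
    omega
  let u : (Fin n →₀ ℕ) → Fin n → ℕ := fun f j => (w f j + H).toNat
  have hu : ∀ f ∈ Q.support, ∀ j, (u f j : ℤ) = w f j + H := fun f hf j =>
    Int.toNat_of_nonneg (hH f hf j)
  have hes : e ∈ Q.support := mem_support_iff.2 (by rw [he]; exact one_ne_zero)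
  refine Ideal.sum_mul_prod_pow_ne_zero_of_chain hP hmono hx hx' Q.support
    (fun f => algebraMap D B (Q.coeff f)) u hes (by simp only [he, map_one]) ?_ (Subtype.ext ?_)
  · intro f hf hne
    obtain ⟨i, h1, h2⟩ := hQ f hf hne
    refine ⟨i, fun j hj => ?_, ?_⟩
    · exact congrArg (fun z : ℤ => (z + H).toNat) (h1 j hj)
    · have h2 : w e i < w f i := h2
      have := hu e hes i
      have := hu f hf i
      omega
  · have hrel : ∑ f ∈ Q.support, algebraMap D K (Q.coeff f) * ∏ j, (x j : K) ^ w f j = 0 := by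
      rw [← map_zero (algebraMap D K), ← hQa, eval_eq', map_sum]
      refine Finset.sum_congr rfl fun f _ => ?_
      rw [map_mul, map_prod, ← hmon]
      simp only [map_pow]
    have hmul := congrArg (· * ∏ j, (x j : K) ^ (H : ℤ)) hrel
    simp only [zero_mul, Finset.sum_mul] at hmul
    rw [ZeroMemClass.coe_zero, ← hmul, AddSubmonoidClass.coe_finsetSum]
    refine Finset.sum_congr rfl fun f hf => ?_
    rw [mul_assoc, ← Finset.prod_mul_distrib, MulMemClass.coe_mul, SubmonoidClass.coe_finsetProd]
    congr 1
    refine Finset.prod_congr rfl fun j _ => ?_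
    rw [← zpow_add₀ (hx0 j), ← hu f hf j, zpow_natCast, SubmonoidClass.coe_pow]

end MvPolynomial

namespace MvPolynomial

/-- An overring of dimension at least `n` yields a strictly independent sequence of length `n`, if
the first row of the matrix is positive. -/
theorem exists_not_strictlyDependent_of_le_ringKrullDim {D K : Type*} [CommRing D] [IsDomain D]
    [Field K] [Algebra D K] [IsFractionRing D K] {k : ℕ}
    {N : Matrix (Fin (k + 1)) (Fin (k + 1)) ℤ} (hN : ∀ i, 0 < N 0 i) (B : Subalgebra D K)
    (hB : ((k + 1 : ℕ) : WithBot ℕ∞) ≤ ringKrullDim B) :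
    ∃ a : Fin (k + 1) → D, ¬ StrictlyDependent (lexWeight N) a := by
  classical
  obtain ⟨l, hl⟩ := Order.le_krullDim_iff.1 hB
  let p : Fin (k + 2) → PrimeSpectrum B := fun i => l (i.cast (by rw [hl]))
  have hp : StrictMono p := fun i j hij => l.strictMono hij
  -- With the zero ideal at the bottom, `x 0` need only be nonzero outside it, so it may be
  -- multiplied freely by nonzero elements.
  let q : Fin (k + 2) → PrimeSpectrum B := Fin.cons ⊥ fun i => p i.succ
  have hq : StrictMono q := by
    refine Fin.strictMono_iff_lt_succ.2 fun i => ?_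
    refine Fin.cases ?_ (fun j => ?_) i
    · exact bot_le.trans_lt (hp (Fin.castSucc_lt_succ (i := 0)))
    · exact hp (Fin.castSucc_lt_succ (i := j.succ))
  have hsep : ∀ i : Fin (k + 1), ∃ x, x ∈ (q i.succ).asIdeal ∧ x ∉ (q i.castSucc).asIdeal :=
    fun i => SetLike.exists_of_lt (hq (Fin.castSucc_lt_succ (i := i)))
  choose x hx hx' using hsep
  have hx0 : ∀ i, (x i : K) ≠ 0 := fun i hi =>
    hx' i (by rw [show x i = 0 from Subtype.ext hi]; exact zero_mem _)
  -- Inverses are included because entries of `N` below the first row may be negative.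
  obtain ⟨⟨c, hc⟩, hcx⟩ := IsLocalization.exist_integer_multiples_of_finite (nonZeroDivisors D)
    (Sum.elim (fun i => (x i : K)) fun i => (x i : K)⁻¹)
  set γ : K := algebraMap D K c with hγ
  have hγ0 : γ ≠ 0 := by
    rw [hγ, Ne, FaithfulSMul.algebraMap_eq_zero_iff]
    exact nonZeroDivisors.ne_zero hc
  let R : Subring K := (algebraMap D K).range
  have hγR : γ ∈ R := ⟨c, rfl⟩
  have hR : ∀ i, γ * x i ∈ R ∧ γ * (x i : K)⁻¹ ∈ R := by
    intro i
    obtain ⟨d, hd⟩ := hcx (Sum.inl i)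
    obtain ⟨d', hd'⟩ := hcx (Sum.inr i)
    exact ⟨⟨d, by rw [hd, hγ]; exact Algebra.smul_def c _⟩,
      ⟨d', by rw [hd', hγ]; exact Algebra.smul_def c _⟩⟩
  have hRz : ∀ i (z : ℤ), γ ^ z.natAbs * (x i : K) ^ z ∈ R := by
    intro i z
    obtain ⟨m, rfl | rfl⟩ := z.eq_nat_or_neg
    · rw [Int.natAbs_natCast, zpow_natCast, ← mul_pow]
      exact pow_mem (hR i).1 m
    · rw [Int.natAbs_neg, Int.natAbs_natCast, zpow_neg, zpow_natCast, ← inv_pow, ← mul_pow]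
      exact pow_mem (hR i).2 m
  let h : ℕ := ∑ i, ∑ j, (N j i).natAbs
  let y : Fin (k + 1) → B := Fin.cons (x 0 * algebraMap D B c ^ h) fun i => x i.succ
  have hy0 : ((y 0 : B) : K) = x 0 * γ ^ h := rfl
  have hyS : ∀ i : Fin k, y i.succ = x i.succ := fun i => rfl
  have hmem : ∀ i, ∃ d, algebraMap D K d = ∏ j, (y j : K) ^ N j i := by
    intro i
    obtain ⟨z, hz⟩ := Int.eq_ofNat_of_zero_le (hN i).le
    have hz1 : 1 ≤ z := by have := hN i; omega
    have hle : ∑ j, (N j i).natAbs ≤ h * z := by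
      refine le_trans ?_ (Nat.le_mul_of_pos_right h hz1)
      exact Finset.single_le_sum (f := fun i => ∑ j, (N j i).natAbs) (fun _ _ => Nat.zero_le _)
        (Finset.mem_univ i)
    -- The factor `γ ^ h` in `y 0` is raised to `z = N 0 i ≥ 1`; this suffices to clear every
    -- denominator in column `i`, with the surplus power left over.
    have heq : ∏ j, (y j : K) ^ N j i = γ ^ (h * z - ∑ j, (N j i).natAbs) *
        ∏ j, (γ ^ (N j i).natAbs * (x j : K) ^ N j i) := by
      rw [Finset.prod_mul_distrib, Finset.prod_pow_eq_pow_sum, ← mul_assoc, ← pow_add,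
        Nat.sub_add_cancel hle, Fin.prod_univ_succ, Fin.prod_univ_succ, hy0, hz]
      simp only [hyS, zpow_natCast, mul_pow, pow_mul]
      ring
    rw [heq]
    exact mul_mem (pow_mem hγR _) (prod_mem fun j _ => hRz j _)
  choose a ha using hmem
  refine ⟨a, not_strictlyDependent_of_chain N B (P := fun i => (q i).asIdeal) (x := y)
    (fun i => (q i).2) (fun i j hij => hq.monotone hij) (fun i => ?_) (fun i => ?_) ha⟩
  · refine Fin.cases ?_ (fun j => ?_) i
    · exact Ideal.mul_mem_right _ _ (hx 0)
    · exact hx j.succ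
  · refine Fin.cases ?_ (fun j => ?_) i
    · intro hy
      have hy : y 0 = 0 := hy
      refine mul_ne_zero (hx0 0) (pow_ne_zero h hγ0) ?_
      rw [← hy0, hy, ZeroMemClass.coe_zero]
    · exact hx' j.succ

/-- Values below `k + 1` are at most `k`, so a supremum cannot reach `k + 1` unless a member does.
-/
theorem _root_.WithBot.exists_natCast_succ_le_of_le_iSup {ι : Sort*} {f : ι → WithBot ℕ∞} {k : ℕ}
    (h : ((k + 1 : ℕ) : WithBot ℕ∞) ≤ ⨆ i, f i) : ∃ i, ((k + 1 : ℕ) : WithBot ℕ∞) ≤ f i := by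
  by_contra! hlt
  have hle : ⨆ i, f i ≤ (k : WithBot ℕ∞) := iSup_le fun i => by
    have hi := hlt i
    cases hfi : f i with
    | bot => exact bot_le
    | coe m =>
      rw [hfi] at hi
      have hm : m < (k : ℕ∞) + 1 := by exact_mod_cast hi
      exact_mod_cast Order.le_of_lt_add_one hm
  have : ((k + 1 : ℕ) : WithBot ℕ∞) ≤ (k : ℕ) := h.trans hle
  exact absurd (Nat.cast_le.1 this) (Nat.not_succ_le_self k)

theorem valuativeDim_lt_of_forall_strictlyDependent {A : Type*} [CommRing A] {k : ℕ}
    {N : Matrix (Fin (k + 1)) (Fin (k + 1)) ℤ} (hN : ∀ i, 0 < N 0 i)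
    (hA : ∀ a : Fin (k + 1) → A, StrictlyDependent (lexWeight N) a) :
    valuativeDim A < (k + 1 : ℕ) := by
  by_contra hdim
  obtain ⟨p, hp⟩ := WithBot.exists_natCast_succ_le_of_le_iSup (not_lt.1 hdim)
  obtain ⟨B, hB⟩ := WithBot.exists_natCast_succ_le_of_le_iSup hp
  obtain ⟨a, ha⟩ := exists_not_strictlyDependent_of_le_ringKrullDim hN B hB
  choose s hs using Ideal.Quotient.mk_surjective (I := p.asIdeal)
  refine ha ?_
  have := (hA fun i => s (a i)).quotient p.asIdeal
  simpa only [hs] using this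

end MvPolynomial

/-! ### Comparison with the original preorder and positivity of the first row -/

namespace MonomialPreorder

open MvPolynomial

variable {n : ℕ} {r : MonomialPreorder n} {A : Type*} [CommRing A]

theorem dependent_of_strictlyDependent {Γ : Type*} [AddCommGroup Γ] [LinearOrder Γ]
    {φ : (Fin n →₀ ℕ) →+ Γ} (hφ : ∀ e f, r.lt e f → φ e < φ f) {a : Fin n → A}
    (ha : StrictlyDependent φ a) : r.Dependent a := by
  obtain ⟨P, e, ⟨he, hP⟩, hPa⟩ := ha
  refine ⟨P, hPa, e, he, fun f hf hfe => ?_⟩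
  have hne : f ≠ e := fun h => r.irrefl e (h ▸ hfe)
  exact lt_asymm (hP f hf hne) (hφ f e hfe)

theorem Dependent.strictlyDependent {Γ : Type*} [AddCommGroup Γ] [LinearOrder Γ]
    {φ : (Fin n →₀ ℕ) →+ Γ} (hφ : ∀ e f, r.lt e f → φ e < φ f) (hr : r.IsOrder) {a : Fin n → A}
    (ha : r.Dependent a) : StrictlyDependent φ a := by
  obtain ⟨P, hPa, e, he, hP⟩ := ha
  exact ⟨P, e, ⟨he, fun f hf hne => hφ e f ((hr f e hne).resolve_left (hP f hf))⟩, hPa⟩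

/-- For a graded monomial order, the first row of a full-rank matrix is positive. -/
theorem IsGraded.first_row_pos {k : ℕ} {r : MonomialPreorder (k + 1)} (hg : r.IsGraded)
    (hr : r.IsOrder) {N : Matrix (Fin (k + 1)) (Fin (k + 1)) ℤ}
    (hN : ∀ i, ∃ y : Fin (k + 1) → ℤ, (∀ j < i, N.mulVec y j = 0) ∧ 0 < N.mulVec y i)
    (hφ : ∀ e f, r.lt e f → lexWeight N e < lexWeight N f) (i : Fin (k + 1)) : 0 < N 0 i := by
  have hfirst : ∀ e f, r.lt e f →
      N.mulVec (fun i => (e i : ℤ)) 0 ≤ N.mulVec (fun i => (f i : ℤ)) 0 := by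
    intro e f hef
    obtain ⟨j, h1, h2⟩ := hφ e f hef
    rcases (Fin.zero_le j).eq_or_lt with rfl | hj
    · exact le_of_lt h2
    · exact le_of_eq (h1 0 hj)
  have hsingle : ∀ (i : Fin (k + 1)) (m : ℕ),
      N.mulVec (fun j => ((Finsupp.single i m j : ℕ) : ℤ)) 0 = N 0 i * m := by
    intro i m
    rw [Matrix.mulVec, dotProduct, Finset.sum_eq_single i]
    · rw [Finsupp.single_eq_same]
    · intro j _ hj
      rw [Finsupp.single_eq_of_ne hj, Nat.cast_zero, mul_zero]
    · exact fun h => absurd (Finset.mem_univ _) h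
  have hnonneg : ∀ i, 0 ≤ N 0 i := by
    intro i
    have := hfirst _ _ (r.zero_lt_single i)
    rw [hsingle, Nat.cast_one, mul_one] at this
    refine le_trans (le_of_eq ?_) this
    simp [Matrix.mulVec, dotProduct]
  refine lt_of_le_of_ne (hnonneg i) fun hi => ?_
  obtain ⟨j, hj⟩ : ∃ j, 0 < N 0 j := by
    by_contra! hle
    obtain ⟨y, -, hy⟩ := hN 0
    refine hy.ne' ?_
    rw [Matrix.mulVec, dotProduct]
    exact Finset.sum_eq_zero fun j _ => by rw [le_antisymm (hle j) (hnonneg j), zero_mul]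
  obtain ⟨m, G, hG, hGpos⟩ := hg
  have hGsingle : ∀ (i : Fin (k + 1)) (m : ℕ),
      G.mulVec (fun j => ((Finsupp.single i m j : ℕ) : ℝ)) 0 = G 0 i * m := by
    intro i m
    rw [Matrix.mulVec, dotProduct, Finset.sum_eq_single i]
    · rw [Finsupp.single_eq_same]
    · intro j _ hj
      rw [Finsupp.single_eq_of_ne hj, Nat.cast_zero, mul_zero]
    · exact fun h => absurd (Finset.mem_univ _) h
  -- With `N 0 i = 0 < N 0 j`, every power of `X_i` lies below `X_j`; the positive first row of `G`
  -- makes this impossible for large powers.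
  have hbound : ∀ t : ℕ, G 0 i * t ≤ G 0 j := by
    intro t
    have hlt : r.lt (Finsupp.single i t) (Finsupp.single j 1) := by
      by_contra hnot
      have hne : Finsupp.single i t ≠ Finsupp.single j 1 := by
        intro h
        have h' := hsingle i t
        rw [h, hsingle, ← hi] at h'
        simp only [Nat.cast_one, mul_one, zero_mul] at h'
        exact hj.ne' h'
      have := hfirst _ _ ((hr _ _ hne).resolve_left hnot)
      rw [hsingle, hsingle, ← hi, Nat.cast_one, mul_one, zero_mul] at this
      exact this.not_gt hj
    obtain ⟨l, h1, h2⟩ := (hG _ _).1 hlt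
    have : G.mulVec (fun l => ((Finsupp.single i t l : ℕ) : ℝ)) 0 ≤
        G.mulVec (fun l => ((Finsupp.single j 1 l : ℕ) : ℝ)) 0 := by
      rcases (Fin.zero_le l).eq_or_lt with rfl | hl
      · exact le_of_lt h2
      · exact le_of_eq (h1 0 hl)
    rwa [hGsingle, hGsingle, Nat.cast_one, mul_one] at this
  obtain ⟨t, ht⟩ := exists_nat_gt (G 0 j / G 0 i)
  rw [div_lt_iff₀' (hGpos i)] at ht
  exact (hbound t).not_gt ht

end MonomialPreorder

theorem theorem3p1 {A : Type*} [CommRing A] (n : ℕ) (hn : 0 < n) (r : MonomialPreorder n)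
    (hr : r.IsRational) :
    (valuativeDim A < (n : WithBot ℕ∞) → ∀ a : Fin n → A, r.Dependent a) ∧
    (r.IsOrder → r.IsGraded →
      (∀ a : Fin n → A, r.Dependent a) → valuativeDim A < (n : WithBot ℕ∞)) := by
  obtain ⟨N, hN, hφ⟩ := hr.exists_lexWeight
  refine ⟨fun hA a => MonomialPreorder.dependent_of_strictlyDependent hφ
    (MvPolynomial.strictlyDependent_of_valuativeDim_lt hN hA a), fun ho hg hA => ?_⟩
  obtain ⟨k, rfl⟩ := Nat.exists_eq_succ_of_ne_zero hn.ne'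
  exact MvPolynomial.valuativeDim_lt_of_forall_strictlyDependent
    (fun i => hg.first_row_pos ho hN hφ i) fun a => (hA a).strictlyDependent hφ ho
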